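/- Let $k$ be a field, $S=k[x_1,\ldots,x_n]$, and order the monomials of $S$ lexicographically with $x_1>x_2>\cdots>x_n$. Let $d\ge 2$, and let $u,v$ be monomials of degree $d$ such that $x_1$ divides $u$ and $x_1$ does not divide $v$ (so $u>_{lex}v$). Let $\mathcal L(u,v)$ be the set of all monomials $w$ of degree $d$ with $u\ge_{lex}w\ge_{lex}v$ (such a set, for monomials $u\ge_{lex}v$ of equal degree, is called a lexsegment), and let $I=(\mathcal L(u,v))\subset S$ be the ideal it generates. The shadow of a set $T$ of monomials is $\{wx_i\mid w\in T,\ 1\le i\le n\}$; a lexsegment is completely lexsegment if all its iterated shadows are lexsegments, and an ideal is a completely lexsegment ideal if it is generated by a completely lexsegment. Suppose that $I$ is not a completely lexsegment ideal. Then $I$ has a linear resolution (that is, for some $e$ its minimal graded free resolution $\cdots\to F_1\to F_0\to I\to 0$ has $F_i\cong S(-e-i)^{\beta_i}$ for all $i\geq 0$) if and only if $I$ has linear quotients (that is, the minimal monomial generators of $I$ can be ordered $u_1,\ldots,u_m$ so that for all $2\le j\le m$ the ideal $(u_1,\ldots,u_{j-1}):u_j$ is generated by a subset of $\{x_1,\ldots,x_n\}$).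 Moreover, if $I$ has a linear resolution, then it has linear quotients with respect to the following ordering of its minimal monomial generators: first the generators not divisible by $x_1$, in decreasing order for $>_{lex}$; then the generators divisible by $x_1$, in decreasing order for the lexicographic order corresponding to $x_n>\cdots>x_2>x_1$. -/

import Mathlib

open MvPolynomial

/-! Monomials of `k[x₁, …, xₙ]` are represented by their exponent vectors `w : Fin n →₀ ℕ`;
the variable `x₁` has index `0 : Fin n`. The order of `Lex (Fin n →₀ ℕ)` is the lexicographic
order with `x₁ > x₂ > ⋯ > xₙ`, and the order of `Colex (Fin n →₀ ℕ)` is the lexicographic order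
with `xₙ > ⋯ > x₂ > x₁`. -/

namespace LexSeg

/-- The set `𝓛(u, v)` of monomials `w` of degree `d` with `u ≥_lex w ≥_lex v`. -/
def lexsegment {n : ℕ} (d : ℕ) (u v : Fin n →₀ ℕ) : Set (Fin n →₀ ℕ) :=
  {w | w.degree = d ∧ toLex w ≤ toLex u ∧ toLex v ≤ toLex w}

/-- A set of monomials is a lexsegment if it is `𝓛(u, v)` for monomials `u ≥_lex v` of the same
degree. -/
def IsLexsegment {n : ℕ} (T : Set (Fin n →₀ ℕ)) : Prop :=
  ∃ (d : ℕ) (u v : Fin n →₀ ℕ), u.degree = d ∧ v.degree = d ∧ toLex v ≤ toLex u ∧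
    T = lexsegment d u v

/-- The shadow of a set `T` of monomials: all products `w xᵢ` with `w ∈ T` and `xᵢ` a variable. -/
def shadow {n : ℕ} (T : Set (Fin n →₀ ℕ)) : Set (Fin n →₀ ℕ) :=
  {t | ∃ w ∈ T, ∃ i : Fin n, t = w + Finsupp.single i 1}

/-- A completely lexsegment: a lexsegment all of whose iterated shadows are lexsegments. -/
def IsCompletelyLexsegment {n : ℕ} (T : Set (Fin n →₀ ℕ)) : Prop :=
  ∀ i : ℕ, IsLexsegment (shadow^[i] T)

/-- The ideal of `k[x₁, …, xₙ]` generated by a set of monomials. -/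
noncomputable def monomialSpan (k : Type*) [Field k] {n : ℕ} (T : Set (Fin n →₀ ℕ)) :
    Ideal (MvPolynomial (Fin n) k) :=
  Ideal.span ((fun w => monomial w (1 : k)) '' T)

/-- A completely lexsegment ideal: an ideal generated by a completely lexsegment. -/
def IsCompletelyLexsegmentIdeal {k : Type*} [Field k] {n : ℕ}
    (I : Ideal (MvPolynomial (Fin n) k)) : Prop :=
  ∃ T : Set (Fin n →₀ ℕ), IsCompletelyLexsegment T ∧ I = monomialSpan k T

/-- The minimal monomial generating set `G(I)` of a monomial ideal `I`: the monomials of `I` that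
are minimal for divisibility (divisibility is the componentwise order of exponent vectors). -/
def minimalGenerators {k : Type*} [Field k] {n : ℕ} (I : Ideal (MvPolynomial (Fin n) k)) :
    Set (Fin n →₀ ℕ) :=
  {w | Minimal (fun m => monomial m (1 : k) ∈ I) w}

/-- The list `l = [u₁, …, uₘ]` enumerates `G(I)`, each element once. -/
def IsGeneratorOrdering {k : Type*} [Field k] {n : ℕ} (I : Ideal (MvPolynomial (Fin n) k))
    (l : List (Fin n →₀ ℕ)) : Prop :=
  l.Nodup ∧ ∀ w, w ∈ l ↔ w ∈ minimalGenerators I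

/-- For `l = [u₁, …, uₘ]`: for all `2 ≤ j ≤ m` the colon ideal `(u₁, …, u_{j-1}) : u_j` is
generated by a subset of the variables. (List positions start at `0`.) -/
def HasVariableColons (k : Type*) [Field k] {n : ℕ} (l : List (Fin n →₀ ℕ)) : Prop :=
  ∀ (j : ℕ) (hj : j < l.length), 0 < j →
    ∃ V : Set (Fin n),
      (monomialSpan k {w | w ∈ l.take j}).colon {monomial l[j] (1 : k)} =
        Ideal.span ((X : Fin n → MvPolynomial (Fin n) k) '' V)

/-- The monomial ideal `I` has linear quotients with respect to the ordering `l` of `G(I)`. -/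
def HasLinearQuotientsFor {k : Type*} [Field k] {n : ℕ} (I : Ideal (MvPolynomial (Fin n) k))
    (l : List (Fin n →₀ ℕ)) : Prop :=
  IsGeneratorOrdering I l ∧ HasVariableColons k l

/-- The monomial ideal `I` has linear quotients (for some ordering of `G(I)`). -/
def HasLinearQuotients {k : Type*} [Field k] {n : ℕ} (I : Ideal (MvPolynomial (Fin n) k)) :
    Prop :=
  ∃ l : List (Fin n →₀ ℕ), HasLinearQuotientsFor I l

/-- A graded free resolution `⋯ → F₂ → F₁ → F₀ → I → 0` by finitely generated graded free modules
over `S = k[x₁, …, xₙ]`, given by matrices: `Fᵢ = ⨁ₐ S(-shift i a)`, the map `F₀ → I` sends the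
`a`-th basis vector to `aug a`, and `F_{i+1} → Fᵢ` is multiplication by the matrix `diff i`. All
these maps are homogeneous of degree `0`. -/
structure GradedFreeResolution {k : Type*} [Field k] {n : ℕ}
    (I : Ideal (MvPolynomial (Fin n) k)) where
  rank : ℕ → ℕ
  shift : (i : ℕ) → Fin (rank i) → ℕ
  aug : Fin (rank 0) → MvPolynomial (Fin n) k
  diff : (i : ℕ) → Matrix (Fin (rank i)) (Fin (rank (i + 1))) (MvPolynomial (Fin n) k)
  aug_homogeneous : ∀ a, (aug a).IsHomogeneous (shift 0 a)
  /-- The entry `(a, b)` is homogeneous of degree `shift (i + 1) b - shift i a` (an integer; the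
  entry is zero if this is negative). -/
  diff_homogeneous : ∀ i a b, ∀ m ∈ (diff i a b).support, m.degree + shift i a = shift (i + 1) b
  span_aug : Ideal.span (Set.range aug) = I
  exact_zero : Function.Exact (fun y => (diff 0).mulVec y) (fun x => ∑ a, x a * aug a)
  exact_succ : ∀ i, Function.Exact (fun y => (diff (i + 1)).mulVec y) (fun x => (diff i).mulVec x)

/-- The resolution is minimal: all entries of the differentials lie in `(x₁, …, xₙ)`. -/
def GradedFreeResolution.IsMinimal {k : Type*} [Field k] {n : ℕ}
    {I : Ideal (MvPolynomial (Fin n) k)} (F : GradedFreeResolution I) : Prop :=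
  ∀ i a b, constantCoeff (F.diff i a b) = 0

/-- `I` has a linear resolution: for some `d` its minimal graded free resolution has
`Fᵢ = S(-d - i)^{βᵢ}` for all `i`. -/
def HasLinearResolution {k : Type*} [Field k] {n : ℕ} (I : Ideal (MvPolynomial (Fin n) k)) :
    Prop :=
  ∃ (d : ℕ) (F : GradedFreeResolution I), F.IsMinimal ∧ ∀ i a, F.shift i a = d + i

/-- The relation `w ≺ w'`: monomials not divisible by `x₁` precede those divisible by `x₁`; among
the former `w ≺ w'` if `w >_lex w'`; among the latter `w ≺ w'` if `w` is larger than `w'` in the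
lexicographic order with `xₙ > ⋯ > x₁`. -/
def Precedes {n : ℕ} [NeZero n] (w w' : Fin n →₀ ℕ) : Prop :=
  (w 0 = 0 ∧ 0 < w' 0) ∨
  (w 0 = 0 ∧ w' 0 = 0 ∧ toLex w' < toLex w) ∨
  (0 < w 0 ∧ 0 < w' 0 ∧ toColex w' < toColex w)

end LexSeg

/-! Linear quotients for generators of one degree give a linear resolution by iteration. For each
generator `j` and each variable `t` in its colon, choose a linear syzygy with coordinate `X t` at
`j` and zeros after `j`. These generate the syzygies, and in the lexicographic order of the pairs
`(j, t)` they have linear quotients again (`exists_linear_syzygies`).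

For the converse, let x_l be the first variable of v and x_z the last variable of the ring. If every
w <_lex v of degree d has some x₁w/xᵢ ≤_lex u, then all shadows are lexsegments
(`ShadowCondition.isCompletelyLexsegment`); so this fails for some w₀. Linear first syzygies connect
generators inside any common multiple (`exists_linear_crossing`). Applied to x₁x_z^(d-1) and x_l^d,
this gives generators w₁, w₂ with w₁xᵢ = w₂x₁, i ∈ {l, z}, where only w₁ is divisible by x₁.
Comparison with w₀ forces v = x_l x_z^(d-1) and u = x₁u' with u' in the variables after x_l
(`initial_form_of_hasLinearResolution`). For this form, exchanging one variable verifies linear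
quotients in the required order (`hasVariableColons_lexsegment`). -/

namespace LexSeg

/-! ### Linear quotients for columns of matrices, and the resolution they produce. -/

section LinearQuotientVectors

variable {k : Type*} [Field k] {n : ℕ}

/-- The span of the columns of `G` with index `< N`. -/
noncomputable def colSpan {r m : ℕ} (G : Matrix (Fin r) (Fin m) (MvPolynomial (Fin n) k)) (N : ℕ) :
    Submodule (MvPolynomial (Fin n) k) (Fin r → MvPolynomial (Fin n) k) :=
  Submodule.span _ {c | ∃ i : Fin m, (i : ℕ) < N ∧ c = G.col i}

/-- The columns of `G` have linear quotients: each colon of a column by the earlier ones is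
generated by variables. -/
def ColLinearQuotients {r m : ℕ} (G : Matrix (Fin r) (Fin m) (MvPolynomial (Fin n) k)) : Prop :=
  ∀ j : Fin m, ∃ V : Set (Fin n), ∀ f : MvPolynomial (Fin n) k,
    f • G.col j ∈ colSpan G j ↔ f ∈ Ideal.span ((X : Fin n → MvPolynomial (Fin n) k) '' V)

theorem mem_colSpan_iff {r m : ℕ} {G : Matrix (Fin r) (Fin m) (MvPolynomial (Fin n) k)} {N : ℕ}
    {x : Fin r → MvPolynomial (Fin n) k} :
    x ∈ colSpan G N ↔ ∃ c : Fin m → MvPolynomial (Fin n) k,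
      (∀ i : Fin m, N ≤ i → c i = 0) ∧ G.mulVec c = x := by
  constructor
  · intro hx
    induction hx using Submodule.span_induction with
    | mem y hy =>
      obtain ⟨i, hi, rfl⟩ := hy
      refine ⟨Pi.single i 1, fun j hj => ?_, by simp⟩
      have : j ≠ i := by rintro rfl; omega
      simp [this]
    | zero => exact ⟨0, by simp, by simp⟩
    | add y z _ _ hy hz =>
      obtain ⟨c, hc, rfl⟩ := hy
      obtain ⟨c', hc', rfl⟩ := hz
      exact ⟨c + c', fun i hi => by simp [hc i hi, hc' i hi], by rw [Matrix.mulVec_add]⟩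
    | smul a y _ hy =>
      obtain ⟨c, hc, rfl⟩ := hy
      exact ⟨a • c, fun i hi => by simp [hc i hi], by rw [Matrix.mulVec_smul]⟩
  · rintro ⟨c, hc, rfl⟩
    rw [Matrix.mulVec_eq_sum]
    refine Submodule.sum_mem _ fun i _ => ?_
    by_cases hi : (i : ℕ) < N
    · have : G.col i ∈ colSpan G N := Submodule.subset_span ⟨i, hi, rfl⟩
      rw [op_smul_eq_smul]
      exact Submodule.smul_mem _ (c i) this
    · simp [hc i (not_lt.mp hi)]

theorem homogeneousComponent_mul_of_isHomogeneous {p q : MvPolynomial (Fin n) k} {e i : ℕ}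
    (hq : q.IsHomogeneous e) :
    homogeneousComponent (i + e) (p * q) = homogeneousComponent i p * q := by
  let _ := gradedAlgebra (R := k) (σ := Fin n)
  have h := DirectSum.coe_decompose_mul_add_of_right_mem
    (homogeneousSubmodule (Fin n) k) (a := p) (i := i) (j := e)
    ((mem_homogeneousSubmodule e q).mpr hq)
  rwa [← DirectSum.Decomposition.decompose'_eq, decomposition.decompose'_apply,
    decomposition.decompose'_apply] at h

/-- The pairs `(j, t)` with `t ∈ V j` in lexicographic order. -/
theorem exists_lex_enumeration {m n : ℕ} (V : Fin m → Set (Fin n)) :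
    ∃ (N : ℕ) (f : Fin N → Fin m × Fin n), (∀ j, ∀ t ∈ V j, ∃ b, f b = (j, t)) ∧
      (∀ b, (f b).2 ∈ V (f b).1) ∧
      ∀ a b, a < b ↔ (f a).1 < (f b).1 ∨ (f a).1 = (f b).1 ∧ (f a).2 < (f b).2 := by
  classical
  let T : Finset (Fin m ×ₗ Fin n) := Finset.univ.filter fun p => (ofLex p).2 ∈ V (ofLex p).1
  let o := T.orderIsoOfFin rfl
  refine ⟨T.card, fun b => ofLex (o b).1, fun j t ht => ?_, fun b => ?_, fun a b => ?_⟩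
  · have hmem : toLex (j, t) ∈ T := by simpa [T] using ht
    exact ⟨o.symm ⟨_, hmem⟩, by simp⟩
  · exact (Finset.mem_filter.mp (o b).2).2
  · rw [← o.lt_iff_lt, ← Subtype.coe_lt_coe, Prod.Lex.lt_iff]

/-- A relation expressing `X t` times a column through the earlier ones may be taken linear. -/
theorem exists_linear_relation {r m e : ℕ} {G : Matrix (Fin r) (Fin m) (MvPolynomial (Fin n) k)}
    (hG : ∀ a b, (G a b).IsHomogeneous e) {j : Fin m} {t : Fin n}
    (h : (X t : MvPolynomial (Fin n) k) • G.col j ∈ colSpan G j) :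
    ∃ s : Fin m → MvPolynomial (Fin n) k, G.mulVec s = 0 ∧ (∀ i, (s i).IsHomogeneous 1) ∧
      s j = X t ∧ ∀ i, j < i → s i = 0 := by
  obtain ⟨c, hc, hcs⟩ := mem_colSpan_iff.mp h
  -- Compare components of degree `1 + e`: the columns have degree `e`, so only the linear parts of
  -- the coefficients contribute.
  have key : G.mulVec (fun i => homogeneousComponent 1 (c i)) =
      (X t : MvPolynomial (Fin n) k) • G.col j := by
    funext a
    have ha := congrArg (homogeneousComponent (1 + e)) (congrFun hcs a)
    simp only [Matrix.mulVec, dotProduct, map_sum, Pi.smul_apply, Matrix.col_apply,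
      smul_eq_mul] at ha ⊢
    rw [homogeneousComponent_mul_of_isHomogeneous (hG a j),
      homogeneousComponent_eq_self (isHomogeneous_X k t)] at ha
    rw [← ha]
    refine Finset.sum_congr rfl fun i _ => ?_
    rw [mul_comm (G a i) (c i), homogeneousComponent_mul_of_isHomogeneous (hG a i), mul_comm]
  refine ⟨Pi.single j (X t) - fun i => homogeneousComponent 1 (c i), ?_, ?_, ?_, ?_⟩
  · rw [Matrix.mulVec_sub, key, Matrix.mulVec_single]
    funext a; simp [mul_comm]
  · intro i
    refine IsHomogeneous.sub ?_ (homogeneousComponent_isHomogeneous 1 _)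
    by_cases hij : i = j
    · subst hij; simpa using isHomogeneous_X k t
    · simpa [hij] using isHomogeneous_zero _ _ _
  · simp [hc j le_rfl]
  · intro i hi
    simp [hi.ne', hc i hi.le]

/-- The syzygies of columns with linear quotients are generated by linear syzygies, which have
linear quotients again. -/
theorem exists_linear_syzygies {r m e : ℕ}
    {G : Matrix (Fin r) (Fin m) (MvPolynomial (Fin n) k)}
    (hG : ∀ a b, (G a b).IsHomogeneous e) (hLQ : ColLinearQuotients G) :
    ∃ (m' : ℕ) (H : Matrix (Fin m) (Fin m') (MvPolynomial (Fin n) k)),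
      (∀ a b, (H a b).IsHomogeneous 1) ∧ ColLinearQuotients H ∧
      Function.Exact (fun y => H.mulVec y) (fun y => G.mulVec y) := by
  classical
  choose V hV using hLQ
  have hrel : ∀ (j : Fin m) (t : Fin n), ∃ s : Fin m → MvPolynomial (Fin n) k, t ∈ V j →
      G.mulVec s = 0 ∧ (∀ i, (s i).IsHomogeneous 1) ∧ s j = X t ∧ ∀ i, j < i → s i = 0 := by
    intro j t
    by_cases ht : t ∈ V j
    · obtain ⟨s, hs⟩ := exists_linear_relation hG
        ((hV j _).mpr (Ideal.subset_span (Set.mem_image_of_mem X ht)))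
      exact ⟨s, fun _ => hs⟩
    · exact ⟨0, fun h => absurd h ht⟩
  choose s hs using hrel
  obtain ⟨N', o, hosurj, hoV, holt⟩ := exists_lex_enumeration V
  let H : Matrix (Fin m) (Fin N') (MvPolynomial (Fin n) k) :=
    Matrix.of fun a b => s (o b).1 (o b).2 a
  have hcol : ∀ b, H.col b = s (o b).1 (o b).2 := fun b => rfl
  let K : ℕ → Submodule (MvPolynomial (Fin n) k) (Fin m → MvPolynomial (Fin n) k) := fun N =>
    Submodule.span _ {c | ∃ (j : Fin m) (t : Fin n), t ∈ V j ∧ (j : ℕ) < N ∧ c = s j t}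
  have hKmono : ∀ N, K N ≤ K (N + 1) := fun N =>
    Submodule.span_mono fun c ⟨j, t, ht, hj, hc⟩ => ⟨j, t, ht, by omega, hc⟩
  -- syzygies supported below `N` come from the chosen ones below `N`
  have hker : ∀ N : ℕ, ∀ y : Fin m → MvPolynomial (Fin n) k, (∀ i : Fin m, N ≤ i → y i = 0) →
      G.mulVec y = 0 → y ∈ K N := by
    intro N
    induction N with
    | zero =>
      intro y hy _
      have : y = 0 := funext fun i => hy i (Nat.zero_le _)
      simp [this]
    | succ N ih =>
      intro y hy hGy
      by_cases hN : N < m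
      · obtain ⟨j, hj⟩ : ∃ j : Fin m, (j : ℕ) = N := ⟨⟨N, hN⟩, rfl⟩
        have hge : ∀ i : Fin m, N ≤ i → i ≠ j → N + 1 ≤ i := fun i hi hij => by
          have : (i : ℕ) ≠ j := fun h => hij (Fin.ext h)
          omega
        -- The last possibly nonzero coordinate of a syzygy lies in the colon at that position.
        have hmem : y j • G.col j ∈ colSpan G j := by
          rw [mem_colSpan_iff]
          refine ⟨Pi.single j (y j) - y, fun i hi => ?_, ?_⟩
          · by_cases hij : i = j
            · subst hij; simp
            · simp [hij, hy i (hge i (hj ▸ hi) hij)]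
          · rw [Matrix.mulVec_sub, hGy, Matrix.mulVec_single]
            funext a; simp [mul_comm]
        -- Every element of the colon at `j` is the last coordinate of a combination of chosen
        -- syzygies; subtracting such a combination from `y` lowers its support.
        have hz : ∀ f ∈ Ideal.span ((X : Fin n → MvPolynomial (Fin n) k) '' V j),
            ∃ z ∈ K (N + 1), z j = f ∧ (∀ i : Fin m, N + 1 ≤ i → z i = 0) ∧ G.mulVec z = 0 := by
          intro f hf
          induction hf using Submodule.span_induction with
          | mem f hf =>
            obtain ⟨t, ht, rfl⟩ := hf
            exact ⟨s j t, Submodule.subset_span ⟨_, _, ht, by omega, rfl⟩,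
              (hs _ _ ht).2.2.1, fun i hi => (hs _ _ ht).2.2.2 _ (Fin.lt_def.mpr (by omega)),
              (hs _ _ ht).1⟩
          | zero => exact ⟨0, Submodule.zero_mem _, rfl, fun _ _ => rfl, by simp⟩
          | add f g _ _ hf hg =>
            obtain ⟨z, hz, h1, h2, h3⟩ := hf
            obtain ⟨z', hz', h1', h2', h3'⟩ := hg
            exact ⟨z + z', Submodule.add_mem _ hz hz', by simp [h1, h1'],
              fun i hi => by simp [h2 i hi, h2' i hi], by simp [Matrix.mulVec_add, h3, h3']⟩
          | smul a f _ hf =>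
            obtain ⟨z, hz, h1, h2, h3⟩ := hf
            exact ⟨a • z, Submodule.smul_mem _ _ hz, by simp [h1],
              fun i hi => by simp [h2 i hi], by simp [Matrix.mulVec_smul, h3]⟩
        obtain ⟨z, hz, h1, h2, h3⟩ := hz _ ((hV j _).mp hmem)
        have hyz := ih (y - z) (fun i hi => by
          by_cases hij : i = j
          · subst hij; simp [h1]
          · simp [hy i (hge i hi hij), h2 i (hge i hi hij)])
          (by rw [Matrix.mulVec_sub, hGy, h3, sub_zero])
        simpa using Submodule.add_mem _ (hKmono N hyz) hz
      · exact hKmono N (ih y (fun i hi => by have := i.2; omega) hGy)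
  have hK : ∀ (b : Fin N'), K (o b).1 ≤ colSpan H b := by
    intro b
    rw [Submodule.span_le]
    rintro c ⟨i, t, ht, hi, rfl⟩
    obtain ⟨a, ha⟩ := hosurj i t ht
    refine Submodule.subset_span ⟨a, Fin.lt_def.mp ((holt a b).mpr (Or.inl ?_)), ?_⟩
    · rw [ha]; exact hi
    · rw [hcol, ha]
  refine ⟨N', H, fun a b => (hs _ _ (hoV b)).2.1 a, fun b => ?_, fun y => ⟨fun hy => ?_, ?_⟩⟩
  · have hb := hs _ _ (hoV b)
    -- The colon at the syzygy of `(j, t)` is generated by the variables of `V j` that precede `t`.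
    refine ⟨{x | x ∈ V (o b).1 ∧ x < (o b).2}, fun f => ⟨fun hf => ?_, fun hf => ?_⟩⟩
    -- At coordinate `j`, syzygies from earlier blocks vanish and the earlier ones of the same block
    -- contribute their own variable.
    · have hcoord : ∀ x ∈ colSpan H b, x (o b).1 ∈ Ideal.span
          ((X : Fin n → MvPolynomial (Fin n) k) '' {x | x ∈ V (o b).1 ∧ x < (o b).2}) := by
        intro x hx
        induction hx using Submodule.span_induction with
        | mem x hx =>
          obtain ⟨a, hab, rfl⟩ := hx
          rw [hcol]
          rcases (holt a b).mp (Fin.lt_def.mpr hab) with h | ⟨h, h'⟩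
          · rw [(hs _ _ (hoV a)).2.2.2 _ h]; exact Ideal.zero_mem _
          · rw [← h, (hs _ _ (hoV a)).2.2.1]
            exact Ideal.subset_span ⟨(o a).2, ⟨hoV a, h'⟩, rfl⟩
        | zero => exact Ideal.zero_mem _
        | add x y _ _ hx hy => exact Ideal.add_mem _ hx hy
        | smul a x _ hx => exact Ideal.mul_mem_left _ a hx
      have h := hcoord _ hf
      -- The factor `X t` can be cancelled because `t` is not among the generating variables.
      rw [hcol, Pi.smul_apply, hb.2.2.1, smul_eq_mul, mem_ideal_span_X_image] at h
      rw [mem_ideal_span_X_image]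
      intro a ha
      obtain ⟨i, hi, hai⟩ := h (a + Finsupp.single (o b).2 1) (by
        rw [mem_support_iff, coeff_mul_X]; exact mem_support_iff.mp ha)
      refine ⟨i, hi, ?_⟩
      have : i ≠ (o b).2 := ne_of_lt hi.2
      simpa [Finsupp.single_apply, this.symm] using hai
    · induction hf using Submodule.span_induction with
      | mem f hf =>
        obtain ⟨x, ⟨hx, hxt⟩, rfl⟩ := hf
        rw [hcol]
        have hx' := hs _ _ hx
        -- The coordinates at `j` cancel in this Koszul-type combination, so it is a syzygy
        -- supported below `j`.
        have hmem := hker (o b).1 ((X x : MvPolynomial (Fin n) k) • s (o b).1 (o b).2 -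
            (X (o b).2 : MvPolynomial (Fin n) k) • s (o b).1 x) (fun i hi => by
          by_cases hij : i = (o b).1
          · subst hij; simp [hb.2.2.1, hx'.2.2.1, mul_comm]
          · have : (o b).1 < i := lt_of_le_of_ne (Fin.le_def.mpr hi) (Ne.symm hij)
            simp [hb.2.2.2 i this, hx'.2.2.2 i this]) (by
          rw [Matrix.mulVec_sub, Matrix.mulVec_smul, Matrix.mulVec_smul, hb.1, hx'.1]; simp)
        have h1 : s (o b).1 x ∈ colSpan H b := by
          obtain ⟨a, ha⟩ := hosurj _ _ hx
          refine Submodule.subset_span ⟨a, Fin.lt_def.mp ((holt a b).mpr (Or.inr ?_)), ?_⟩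
          · rw [ha]; exact ⟨rfl, hxt⟩
          · rw [hcol, ha]
        have := Submodule.add_mem _ (hK b hmem)
          (Submodule.smul_mem _ (X (o b).2 : MvPolynomial (Fin n) k) h1)
        simpa using this
      | zero => rw [zero_smul]; exact Submodule.zero_mem _
      | add f g _ _ hf hg => rw [add_smul]; exact Submodule.add_mem _ hf hg
      | smul a f _ hf => rw [smul_assoc]; exact Submodule.smul_mem _ _ hf
  · have h := hker m y (fun i hi => absurd i.2 (by omega)) hy
    have hle : K m ≤ colSpan H N' := by
      rw [Submodule.span_le]
      rintro c ⟨i, t, ht, -, rfl⟩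
      obtain ⟨a, ha⟩ := hosurj _ _ ht
      exact Submodule.subset_span ⟨a, a.2, by rw [hcol, ha]⟩
    obtain ⟨c, -, hc⟩ := mem_colSpan_iff.mp (hle h)
    exact ⟨c, hc⟩
  · rintro ⟨c, rfl⟩
    have : G * H = 0 := by
      apply Matrix.ext
      intro a b
      exact congrFun (hs _ _ (hoV b)).1 a
    simp [Matrix.mulVec_mulVec, this]

/-- A matrix with homogeneous columns of one degree having linear quotients. -/
structure LinearQuotientMatrix (k : Type*) [Field k] (n : ℕ) where
  rows : ℕ
  cols : ℕ
  mat : Matrix (Fin rows) (Fin cols) (MvPolynomial (Fin n) k)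
  deg : ℕ
  hom : ∀ a b, (mat a b).IsHomogeneous deg
  linearQuotients : ColLinearQuotients mat

/-- The matrix of linear generators of the syzygies. -/
noncomputable def LinearQuotientMatrix.next (A : LinearQuotientMatrix k n) :
    LinearQuotientMatrix k n where
  rows := A.cols
  cols := (exists_linear_syzygies A.hom A.linearQuotients).choose
  mat := (exists_linear_syzygies A.hom A.linearQuotients).choose_spec.choose
  deg := 1
  hom := (exists_linear_syzygies A.hom A.linearQuotients).choose_spec.choose_spec.1
  linearQuotients := (exists_linear_syzygies A.hom A.linearQuotients).choose_spec.choose_spec.2.1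

theorem LinearQuotientMatrix.exact_next (A : LinearQuotientMatrix k n) :
    Function.Exact (fun y => A.next.mat.mulVec y) (fun y : Fin A.cols → _ => A.mat.mulVec y) :=
  (exists_linear_syzygies A.hom A.linearQuotients).choose_spec.choose_spec.2.2

/-- The iterated syzygy matrices. -/
noncomputable def LinearQuotientMatrix.stage (A : LinearQuotientMatrix k n) :
    ℕ → LinearQuotientMatrix k n
  | 0 => A
  | i + 1 => (A.stage i).next

/-- Iterating the syzygy construction from the one-row matrix of generators gives a resolution whose
differentials all have linear entries; this is also why it is minimal. -/
theorem hasLinearResolution_of_colLinearQuotients {m e : ℕ}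
    (g : Fin m → MvPolynomial (Fin n) k) (hg : ∀ j, (g j).IsHomogeneous e)
    (hLQ : ColLinearQuotients (Matrix.of fun (_ : Fin 1) j => g j)) :
    HasLinearResolution (Ideal.span (Set.range g)) := by
  let A : LinearQuotientMatrix k n := ⟨1, m, Matrix.of fun _ j => g j, e, fun _ j => hg j, hLQ⟩
  have hd : ∀ i a b, ((A.stage (i + 1)).mat a b).IsHomogeneous 1 := fun i => (A.stage i).next.hom
  refine ⟨e, ⟨fun i => (A.stage i).cols, fun i _ => e + i, g, fun i => (A.stage (i + 1)).mat, hg,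
    fun i a b x hx => ?_, rfl, ?_, fun i => (A.stage (i + 1)).exact_next⟩, fun i a b => ?_,
    fun _ _ => rfl⟩
  · have h : x.degree = 1 := by
      by_contra h
      exact mem_support_iff.mp hx ((hd i a b).coeff_eq_zero h)
    omega
  · intro y
    refine Iff.trans ?_ (A.exact_next y)
    rw [_root_.funext_iff]
    simp only [Fin.forall_fin_one, A, Matrix.mulVec, dotProduct, Matrix.of_apply]
    simp only [mul_comm]
    exact Iff.rfl
  · exact (hd i a b).coeff_eq_zero (by simp)

end LinearQuotientVectors

/-! ### Monomial ideals generated in one degree. -/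

section MonomialIdeals

variable {k : Type*} [Field k] {n : ℕ}

theorem mem_monomialSpan_iff {T : Set (Fin n →₀ ℕ)} {f : MvPolynomial (Fin n) k} :
    f ∈ monomialSpan k T ↔ ∀ m ∈ f.support, ∃ w ∈ T, w ≤ m :=
  mem_ideal_span_monomial_image

theorem monomial_mem_monomialSpan_iff {T : Set (Fin n →₀ ℕ)} {m : Fin n →₀ ℕ} :
    monomial m (1 : k) ∈ monomialSpan k T ↔ ∃ w ∈ T, w ≤ m := by
  classical
  rw [mem_monomialSpan_iff, support_monomial, if_neg one_ne_zero]
  simp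

theorem eq_of_le_of_degree_eq {w m : Fin n →₀ ℕ} (h : w ≤ m) (hd : w.degree = m.degree) :
    w = m := by
  obtain ⟨c, rfl⟩ := exists_add_of_le h
  rw [map_add] at hd
  have : c = 0 := (Finsupp.degree_eq_zero_iff c).mp (by omega)
  simp [this]

theorem degree_le_degree {w m : Fin n →₀ ℕ} (h : w ≤ m) : w.degree ≤ m.degree := by
  obtain ⟨c, rfl⟩ := exists_add_of_le h
  simp

/-- Divisibility between monomials of equal degree is equality, so no generator is redundant. -/
theorem minimalGenerators_monomialSpan {T : Set (Fin n →₀ ℕ)} {d : ℕ}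
    (hT : ∀ w ∈ T, w.degree = d) : minimalGenerators (monomialSpan k T) = T := by
  ext w
  simp only [minimalGenerators, Set.mem_ofPred_eq, minimal_iff, monomial_mem_monomialSpan_iff]
  constructor
  · rintro ⟨⟨m, hm, hmw⟩, h⟩
    rw [h ⟨m, hm, le_rfl⟩ hmw]
    exact hm
  · intro hw
    refine ⟨⟨w, hw, le_rfl⟩, ?_⟩
    rintro y ⟨m, hm, hmy⟩ hyw
    have := eq_of_le_of_degree_eq (hmy.trans hyw) ((hT m hm).trans (hT w hw).symm)
    subst this
    exact le_antisymm hmy hyw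

theorem finite_of_degree_eq {T : Set (Fin n →₀ ℕ)} {d : ℕ} (hT : ∀ w ∈ T, w.degree = d) :
    T.Finite := by
  refine (Set.finite_Iic (Finsupp.equivFunOnFinite.symm fun _ : Fin n => d)).subset ?_
  intro w hw i
  simpa using (Finsupp.le_degree i w).trans (hT w hw).le

/-- For an ideal generated by monomials of one degree, linear quotients yield a linear
resolution. -/
theorem hasLinearResolution_of_hasLinearQuotients {T : Set (Fin n →₀ ℕ)} {d : ℕ}
    (hT : ∀ w ∈ T, w.degree = d) (h : HasLinearQuotients (monomialSpan k T)) :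
    HasLinearResolution (monomialSpan k T) := by
  obtain ⟨l, ⟨-, hl⟩, hcol⟩ := h
  rw [minimalGenerators_monomialSpan hT] at hl
  let g : Fin l.length → MvPolynomial (Fin n) k := fun j => monomial l[j] 1
  have hI : Ideal.span (Set.range g) = monomialSpan k T := by
    unfold monomialSpan
    congr 1
    ext f
    constructor
    · rintro ⟨j, rfl⟩
      exact ⟨l[j], (hl _).mp (List.getElem_mem _), rfl⟩
    · rintro ⟨w, hw, rfl⟩
      obtain ⟨j, hj, rfl⟩ := List.mem_iff_getElem.mp ((hl w).mpr hw)
      exact ⟨⟨j, hj⟩, rfl⟩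
  rw [← hI]
  refine hasLinearResolution_of_colLinearQuotients (e := d) g
    (fun j => isHomogeneous_monomial _ (hT _ ((hl _).mp (List.getElem_mem _)))) fun j => ?_
  have key : ∀ f : MvPolynomial (Fin n) k,
      f • (Matrix.of fun (_ : Fin 1) j => g j).col j ∈
        colSpan (Matrix.of fun (_ : Fin 1) j => g j) j ↔
      f ∈ (monomialSpan k {w | w ∈ l.take j}).colon {monomial l[j] (1 : k)} := by
    intro f
    rw [Submodule.mem_colon_singleton]
    constructor
    · intro hf
      have hcoord : ∀ x ∈ colSpan (Matrix.of fun (_ : Fin 1) j => g j) j,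
          x 0 ∈ monomialSpan k {w | w ∈ l.take j} := by
        intro x hx
        induction hx using Submodule.span_induction with
        | mem x hx =>
          obtain ⟨i, hi, rfl⟩ := hx
          exact Ideal.subset_span ⟨l[i], List.mem_take_iff_getElem.mpr
            ⟨i, by have := j.2; have := i.2; omega, rfl⟩, rfl⟩
        | zero => exact Ideal.zero_mem _
        | add x y _ _ hx hy => exact Ideal.add_mem _ hx hy
        | smul a x _ hx => exact Ideal.mul_mem_left _ a hx
      exact hcoord _ hf
    · intro hf
      have hcoord : ∀ x ∈ monomialSpan k {w | w ∈ l.take j},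
          (fun _ => x) ∈ colSpan (Matrix.of fun (_ : Fin 1) j => g j) j := by
        intro x hx
        induction hx using Submodule.span_induction with
        | mem x hx =>
          obtain ⟨w, hw, rfl⟩ := hx
          obtain ⟨i, hi, rfl⟩ := List.mem_take_iff_getElem.mp hw
          exact Submodule.subset_span ⟨⟨i, by omega⟩, by simp only; omega, rfl⟩
        | zero => exact Submodule.zero_mem _
        | add x y _ _ hx hy => exact Submodule.add_mem _ hx hy
        | smul a x _ hx => exact Submodule.smul_mem _ a hx
      exact hcoord _ hf
  rcases Nat.eq_zero_or_pos (j : ℕ) with h0 | h0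
  -- The first generator is not covered by `HasVariableColons`; there the colon is that of the zero
  -- ideal, hence zero.
  · refine ⟨∅, fun f => ?_⟩
    rw [key, Submodule.mem_colon_singleton, Set.image_empty, Ideal.span_empty, Ideal.mem_bot]
    have : {w | w ∈ l.take j} = ∅ := by simp [h0]
    rw [this]
    simp [monomialSpan]
  · obtain ⟨V, hV⟩ := hcol j j.2 h0
    exact ⟨V, fun f => by rw [key, ← hV]; rfl⟩

/-- A criterion for linear quotients with respect to a list sorted by a strict order. -/
theorem hasVariableColons_of_pairwise {R : (Fin n →₀ ℕ) → (Fin n →₀ ℕ) → Prop}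
    (hR : ∀ a b, R a b → ¬ R b a) {l : List (Fin n →₀ ℕ)} (hl : l.Pairwise R)
    (h : ∀ a ∈ l, ∀ b ∈ l, R a b → ∃ t, b t < a t ∧
      ∃ c ∈ l, R c b ∧ c ≤ b + Finsupp.single t 1) : HasVariableColons k l := by
  intro j hj _
  have hget := List.pairwise_iff_getElem.mp hl
  have htake : ∀ a, a ∈ l.take j ↔ a ∈ l ∧ R a l[j] := by
    intro a
    rw [List.mem_take_iff_getElem]
    constructor
    · rintro ⟨i, hi, rfl⟩
      exact ⟨List.getElem_mem _, hget _ _ _ _ (by omega)⟩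
    · rintro ⟨ha, hR'⟩
      obtain ⟨i, hi, rfl⟩ := List.mem_iff_getElem.mp ha
      rcases lt_trichotomy i j with hij | rfl | hij
      · exact ⟨i, by omega, rfl⟩
      · exact absurd hR' (hR _ _ hR')
      · exact absurd hR' (hR _ _ (hget _ _ _ _ hij))
  -- All variables in the colon are taken; `h` supplies one of them dividing any given monomial of
  -- the colon.
  refine ⟨{t | ∃ c ∈ l.take j, c ≤ l[j] + Finsupp.single t 1}, ?_⟩
  ext f
  rw [Submodule.mem_colon_singleton, smul_eq_mul, mem_monomialSpan_iff, mem_ideal_span_X_image]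
  have hsupp : ∀ m, m + l[j] ∈ (f * monomial l[j] (1 : k)).support ↔ m ∈ f.support := by
    intro m
    rw [mem_support_iff, mem_support_iff, coeff_mul_monomial, mul_one]
  constructor
  · intro hf m hm
    obtain ⟨a, ha, ham⟩ := hf _ ((hsupp m).mpr hm)
    obtain ⟨hal, haR⟩ := (htake a).mp ha
    obtain ⟨t, ht, c, hc, hcR, hct⟩ := h a hal _ (List.getElem_mem hj) haR
    refine ⟨t, ⟨c, (htake c).mpr ⟨hc, hcR⟩, hct⟩, ?_⟩
    have := ham t
    rw [Finsupp.add_apply] at this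
    omega
  · intro hf m hm
    have hle : l[j] ≤ m := by
      by_contra hle
      rw [mem_support_iff, coeff_mul_monomial', if_neg hle] at hm
      exact hm rfl
    obtain ⟨m', rfl⟩ : ∃ m', m = m' + l[j] := ⟨m - l[j], (tsub_add_cancel_of_le hle).symm⟩
    obtain ⟨t, ⟨c, hc, hct⟩, ht⟩ := hf m' ((hsupp m').mp hm)
    refine ⟨c, hc, hct.trans ?_⟩
    rw [add_comm]
    gcongr
    rw [Finsupp.single_le_iff]
    omega

end MonomialIdeals

/-! ### Replacing one variable of a monomial by another. -/

section Exchange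

variable {n : ℕ}

theorem exists_eq_add_single {w : Fin n →₀ ℕ} {i : Fin n} (h : 0 < w i) :
    ∃ c, w = c + Finsupp.single i 1 :=
  ⟨_, (tsub_add_cancel_of_le (by rw [Finsupp.single_le_iff]; omega)).symm⟩

theorem exists_pos_of_degree_pos {w : Fin n →₀ ℕ} (h : 0 < w.degree) : ∃ i, 0 < w i := by
  by_contra! h'
  have : w = 0 := Finsupp.ext fun i => Nat.le_zero.mp (h' i)
  simp [this] at h

theorem add_single_le_add_single {a b : Fin n →₀ ℕ} {i j : Fin n} (h : toLex a ≤ toLex b)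
    (hij : j ≤ i) :
    toLex (a + Finsupp.single i 1) ≤ toLex (b + Finsupp.single j 1) := by
  rw [toLex_add, toLex_add]
  exact add_le_add h (Finsupp.Lex.single_le_iff.mpr hij)

/-- The quotient x_t w / x_s is described by an additive identity, which avoids truncated
subtraction and lets order comparisons proceed by cancellation. -/
theorem exists_exchange {w : Fin n →₀ ℕ} {s : Fin n} (hs : 0 < w s) (t : Fin n) :
    ∃ w', w' + Finsupp.single s 1 = w + Finsupp.single t 1 := by
  obtain ⟨c, rfl⟩ := exists_eq_add_single hs
  exact ⟨c + Finsupp.single t 1, by rw [add_right_comm]⟩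

theorem degree_exchange {w w' : Fin n →₀ ℕ} {s t : Fin n}
    (h : w' + Finsupp.single s 1 = w + Finsupp.single t 1) : w'.degree = w.degree := by
  have := congrArg Finsupp.degree h
  simpa using this

theorem apply_exchange {w w' : Fin n →₀ ℕ} {s t i : Fin n}
    (h : w' + Finsupp.single s 1 = w + Finsupp.single t 1) (his : i ≠ s) (hit : i ≠ t) :
    w' i = w i := by
  have := DFunLike.congr_fun h i
  simpa [Finsupp.single_apply, his.symm, hit.symm] using this

theorem toLex_lt_exchange {w w' : Fin n →₀ ℕ} {s t : Fin n}
    (h : w' + Finsupp.single s 1 = w + Finsupp.single t 1) (hts : t < s) :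
    toLex w < toLex w' := by
  have h1 : toLex w + toLex (Finsupp.single s 1) < toLex w + toLex (Finsupp.single t 1) :=
    add_lt_add_right (Finsupp.Lex.single_lt_iff.mpr hts) _
  rw [← toLex_add, ← toLex_add, ← h, toLex_add, toLex_add] at h1
  exact lt_of_add_lt_add_right h1

theorem toColex_lt_exchange {w w' : Fin n →₀ ℕ} {s t : Fin n}
    (h : w' + Finsupp.single s 1 = w + Finsupp.single t 1) (hst : s < t) :
    toColex w < toColex w' := by
  have h1 : toColex w + toColex (Finsupp.single s 1) < toColex w + toColex (Finsupp.single t 1) :=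
    add_lt_add_right (Finsupp.Colex.single_lt_iff.mpr hst) _
  rw [← toColex_add, ← toColex_add, ← h, toColex_add, toColex_add] at h1
  exact lt_of_add_lt_add_right h1

theorem toLex_lt_iff {a b : Fin n →₀ ℕ} :
    toLex a < toLex b ↔ ∃ i, (∀ j < i, a j = b j) ∧ a i < b i :=
  Finsupp.Lex.lt_iff

theorem toColex_lt_iff {a b : Fin n →₀ ℕ} :
    toColex a < toColex b ↔ ∃ i, (∀ j, i < j → a j = b j) ∧ a i < b i :=
  Finsupp.Colex.lt_iff

/-- If two monomials of the same degree agree outside of the variable `t` and the variables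
satisfying `p`, and `a t < b t`, then `a` exceeds `b` in some variable satisfying `p`. -/
theorem exists_lt_of_degree_eq {a b : Fin n →₀ ℕ} (h : a.degree = b.degree) {t : Fin n}
    (ht : a t < b t) {p : Fin n → Prop} (hp : ∀ i, i ≠ t → ¬ p i → a i = b i) :
    ∃ s, p s ∧ b s < a s := by
  by_contra! hcon
  rw [Finsupp.degree_eq_sum, Finsupp.degree_eq_sum] at h
  refine absurd h (ne_of_lt (Finset.sum_lt_sum (fun i _ => ?_) ⟨t, Finset.mem_univ _, ht⟩))
  by_cases hi : p i
  · exact hcon i hi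
  · by_cases hit : i = t
    · subst hit; exact ht.le
    · exact (hp i hit hi).le

end Exchange

/-! ### `Precedes` is a strict total order, so finite sets can be sorted by it. -/

section Order

variable {n : ℕ} [NeZero n]

theorem Precedes.asymm {a b : Fin n →₀ ℕ} (h : Precedes a b) : ¬ Precedes b a := by
  unfold Precedes at *
  rcases h with h | ⟨h1, h2, h⟩ | ⟨h1, h2, h⟩ <;> rintro (h' | ⟨h1', h2', h'⟩ | ⟨h1', h2', h'⟩) <;>
    first | omega | exact absurd h h'.not_gt

theorem Precedes.trans {a b c : Fin n →₀ ℕ} (h : Precedes a b) (h' : Precedes b c) :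
    Precedes a c := by
  unfold Precedes at *
  rcases h with h | ⟨h1, h2, h⟩ | ⟨h1, h2, h⟩ <;> rcases h' with h' | ⟨h1', h2', h'⟩ | ⟨h1', h2', h'⟩
  · omega
  · omega
  · exact Or.inl ⟨h.1, h2'⟩
  · exact Or.inl ⟨h1, h'.2⟩
  · exact Or.inr (Or.inl ⟨h1, h2', h'.trans h⟩)
  · omega
  · omega
  · omega
  · exact Or.inr (Or.inr ⟨h1, h2', h'.trans h⟩)

theorem precedes_or_eq_or_precedes (a b : Fin n →₀ ℕ) : Precedes a b ∨ a = b ∨ Precedes b a := by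
  unfold Precedes
  rcases Nat.eq_zero_or_pos (a 0) with ha | ha <;> rcases Nat.eq_zero_or_pos (b 0) with hb | hb
  · rcases lt_trichotomy (toLex a) (toLex b) with h | h | h
    · exact Or.inr (Or.inr (Or.inr (Or.inl ⟨hb, ha, h⟩)))
    · exact Or.inr (Or.inl (toLex_inj.mp h))
    · exact Or.inl (Or.inr (Or.inl ⟨ha, hb, h⟩))
  · exact Or.inl (Or.inl ⟨ha, hb⟩)
  · exact Or.inr (Or.inr (Or.inl ⟨hb, ha⟩))
  · rcases lt_trichotomy (toColex a) (toColex b) with h | h | h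
    · exact Or.inr (Or.inr (Or.inr (Or.inr ⟨hb, ha, h⟩)))
    · exact Or.inr (Or.inl (toColex_inj.mp h))
    · exact Or.inl (Or.inr (Or.inr ⟨ha, hb, h⟩))

theorem exists_pairwise_precedes {T : Set (Fin n →₀ ℕ)} (hT : T.Finite) :
    ∃ l : List (Fin n →₀ ℕ), l.Nodup ∧ l.Pairwise Precedes ∧ ∀ w, w ∈ l ↔ w ∈ T := by
  classical
  let r : (Fin n →₀ ℕ) → (Fin n →₀ ℕ) → Prop := fun a b => a = b ∨ Precedes a b
  have : IsTrans _ r := ⟨fun a b c hab hbc => by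
    rcases hab with rfl | hab
    · exact hbc
    · rcases hbc with rfl | hbc
      · exact Or.inr hab
      · exact Or.inr (hab.trans hbc)⟩
  have : Std.Antisymm r := ⟨fun a b hab hba => by
    rcases hab with rfl | hab
    · rfl
    · rcases hba with rfl | hba
      · rfl
      · exact absurd hba hab.asymm⟩
  have : Std.Total r := ⟨fun a b => by
    rcases precedes_or_eq_or_precedes a b with h | h | h
    · exact Or.inl (Or.inr h)
    · exact Or.inl (Or.inl h)
    · exact Or.inr (Or.inr h)⟩
  refine ⟨hT.toFinset.sort r, Finset.sort_nodup _ _, ?_, fun w => by simp⟩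
  refine ((Finset.pairwise_sort _ _).and (Finset.sort_nodup hT.toFinset r)).imp ?_
  rintro a b ⟨h | h, hne⟩
  · exact absurd h hne
  · exact h

end Order

/-! ### Linear first syzygies connect the generators. -/

section Crossing

variable {k : Type*} [Field k] {n : ℕ}

open Classical in
/-- The part of a polynomial supported on a set of monomials. -/
noncomputable def monomialPart (S : Set (Fin n →₀ ℕ)) (f : MvPolynomial (Fin n) k) :
    MvPolynomial (Fin n) k :=
  ∑ m ∈ f.support with m ∈ S, monomial m (coeff m f)

open Classical in
theorem coeff_monomialPart (S : Set (Fin n →₀ ℕ)) (f : MvPolynomial (Fin n) k) (m : Fin n →₀ ℕ) :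
    coeff m (monomialPart S f) = if m ∈ S then coeff m f else 0 := by
  rw [monomialPart, coeff_sum]
  simp only [coeff_monomial]
  rw [Finset.sum_ite_eq' ]
  by_cases hm : m ∈ S <;> by_cases hf : coeff m f = 0 <;> simp [hm, hf]

theorem monomialPart_sum_C_mul (S : Set (Fin n →₀ ℕ)) {r : ℕ} (c : Fin r → k)
    (g : Fin r → MvPolynomial (Fin n) k) :
    monomialPart S (∑ a, C (c a) * g a) = ∑ a, C (c a) * monomialPart S (g a) := by
  classical
  ext m
  simp only [coeff_monomialPart, coeff_sum, coeff_C_mul]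
  by_cases hm : m ∈ S <;> simp [hm]

theorem monomialPart_monomial (S : Set (Fin n →₀ ℕ)) {m : Fin n →₀ ℕ} (hm : m ∈ S) :
    monomialPart S (monomial m (1 : k)) = monomial m 1 := by
  classical
  ext x
  rw [coeff_monomialPart, coeff_monomial]
  split_ifs with h1 h2 h2
  · rfl
  · rfl
  · subst h2; exact absurd hm h1
  · rfl

theorem monomialPart_monomial_of_notMem (S : Set (Fin n →₀ ℕ)) {m : Fin n →₀ ℕ} (hm : m ∉ S) :
    monomialPart S (monomial m (1 : k)) = 0 := by
  classical
  ext x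
  rw [coeff_monomialPart, coeff_monomial, coeff_zero]
  split_ifs with h1 h2
  · subst h2; exact absurd h1 hm
  · rfl
  · rfl

theorem coeff_mul_eq_zero_of_forall_le {f g : MvPolynomial (Fin n) k} {M : Fin n →₀ ℕ}
    (h : ∀ m ≤ M, coeff m g = 0) : coeff M (f * g) = 0 := by
  classical
  rw [coeff_mul]
  refine Finset.sum_eq_zero fun x hx => ?_
  rw [h x.2 (by rw [← Finset.HasAntidiagonal.mem_antidiagonal.mp hx]; exact le_add_self), mul_zero]

/-- If the generators below `M` in `S` are not linked to those outside of `S`, then linear syzygies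
restrict to syzygies of the parts in `S`, as far as coefficients below `M` are concerned. -/
theorem coeff_linear_syzygy_monomialPart {T S : Set (Fin n →₀ ℕ)} {d r : ℕ} {M : Fin n →₀ ℕ}
    (hno : ∀ M' ≤ M, M'.degree = d + 1 → ∀ w₁ ∈ T, ∀ w₂ ∈ T, w₁ ≤ M' → w₂ ≤ M' → w₁ ∈ S → w₂ ∈ S)
    {g σ : Fin r → MvPolynomial (Fin n) k} (hg : ∀ a, (g a).IsHomogeneous d)
    (hgT : ∀ a, ∀ m ∈ (g a).support, m ∈ T) (hσ : ∀ a, (σ a).IsHomogeneous 1)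
    (hsyz : ∑ a, σ a * g a = 0) {M' : Fin n →₀ ℕ} (hM' : M' ≤ M) :
    coeff M' (∑ a, σ a * monomialPart S (g a)) = 0 := by
  classical
  by_cases hdeg : M'.degree = d + 1
  · by_cases h : ∃ w ∈ T, w ≤ M' ∧ w ∈ S
    · obtain ⟨w₁, hw₁, hwM, hwS⟩ := h
      -- One generator in `S` dividing `M'` puts all of them in `S`, so restricting to `S` does not
      -- change this coefficient of the syzygy.
      rw [← coeff_zero M', ← hsyz, coeff_sum, coeff_sum]
      refine Finset.sum_congr rfl fun a _ => ?_
      rw [coeff_mul, coeff_mul]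
      refine Finset.sum_congr rfl fun x hx => ?_
      rw [coeff_monomialPart]
      have hle : x.2 ≤ M' := by rw [← Finset.HasAntidiagonal.mem_antidiagonal.mp hx]; exact le_add_self
      split_ifs with hS
      · rfl
      · have : coeff x.2 (g a) = 0 := by
          by_contra hne
          exact hS (hno M' hM' hdeg w₁ hw₁ x.2 (hgT a _ (mem_support_iff.mpr hne)) hwM hle hwS)
        rw [this]
    · push Not at h
      rw [coeff_sum]
      refine Finset.sum_eq_zero fun a _ => coeff_mul_eq_zero_of_forall_le fun m hm => ?_
      rw [coeff_monomialPart]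
      split_ifs with hS
      · by_contra hne
        exact h m (hgT a _ (mem_support_iff.mpr hne)) hm hS
      · rfl
  · have hhom : (∑ a, σ a * monomialPart S (g a)).IsHomogeneous (1 + d) := by
      refine IsHomogeneous.sum _ _ _ fun a _ => (hσ a).mul fun m hm => hg a ?_
      rw [coeff_monomialPart] at hm
      split_ifs at hm with h
      · exact hm
      · exact absurd rfl hm
    exact hhom.coeff_eq_zero (by omega)

/-- If an ideal generated by monomials of degree `d` has a linear resolution, then two generators
dividing `M` that are separated by `S` force two generators separated by `S` with a common multiple
of degree `d + 1` dividing `M`. -/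
theorem exists_linear_crossing {T S : Set (Fin n →₀ ℕ)} {d : ℕ} (hT : ∀ w ∈ T, w.degree = d)
    (hlin : HasLinearResolution (monomialSpan k T)) {p q M : Fin n →₀ ℕ} (hp : p ∈ T) (hq : q ∈ T)
    (hpS : p ∈ S) (hqS : q ∉ S) (hpM : p ≤ M) (hqM : q ≤ M) :
    ∃ M' ≤ M, M'.degree = d + 1 ∧ ∃ w₁ ∈ T, ∃ w₂ ∈ T, w₁ ≤ M' ∧ w₂ ≤ M' ∧ w₁ ∈ S ∧ w₂ ∉ S := by
  classical
  by_contra hcon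
  have hno : ∀ M' ≤ M, M'.degree = d + 1 → ∀ w₁ ∈ T, ∀ w₂ ∈ T, w₁ ≤ M' → w₂ ≤ M' →
      w₁ ∈ S → w₂ ∈ S := by
    intro M' h1 h2 w₁ h3 w₂ h4 h5 h6 h7
    by_contra h8
    exact hcon ⟨M', h1, h2, w₁, h3, w₂, h4, h5, h6, h7, h8⟩
  obtain ⟨e, F, -, hshift⟩ := hlin
  have haug : ∀ a, (F.aug a).IsHomogeneous e := fun a => by
    have := F.aug_homogeneous a
    rwa [hshift] at this
  have hsuppT : ∀ a, ∀ m ∈ (F.aug a).support, m.degree = e ∧ ∃ w ∈ T, w ≤ m := by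
    intro a m hm
    refine ⟨?_, ?_⟩
    · by_contra h
      exact mem_support_iff.mp hm ((haug a).coeff_eq_zero h)
    · have hmem : F.aug a ∈ monomialSpan k T := by
        exact F.span_aug.le (Ideal.subset_span ⟨a, rfl⟩)
      exact mem_monomialSpan_iff.mp hmem m hm
  have hgen : ∀ w ∈ T, ∃ y : Fin (F.rank 0) → MvPolynomial (Fin n) k,
      ∑ a, y a * F.aug a = monomial w 1 := by
    intro w hw
    have : monomial w (1 : k) ∈ Ideal.span (Set.range F.aug) :=
      F.span_aug.ge (Ideal.subset_span ⟨w, hw, rfl⟩)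
    exact Ideal.mem_span_range_iff_exists_fun.mp this
  -- Monomials of the augmentation lie in the ideal, so `d ≤ e`; one of them divides `p`, so `e ≤
  -- d`.
  have hed : e = d := by
    obtain ⟨y, hy⟩ := hgen p hp
    have hne : coeff p (∑ a, y a * F.aug a) ≠ 0 := by rw [hy]; simp
    rw [coeff_sum] at hne
    obtain ⟨a, -, ha⟩ := Finset.exists_ne_zero_of_sum_ne_zero hne
    obtain ⟨m, hm, hma⟩ : ∃ m ≤ p, coeff m (F.aug a) ≠ 0 := by
      by_contra! h
      exact ha (coeff_mul_eq_zero_of_forall_le h)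
    obtain ⟨h1, w, hw, hwm⟩ := hsuppT a m (mem_support_iff.mpr hma)
    have h2 := degree_le_degree hwm
    have h3 := degree_le_degree hm
    rw [hT w hw] at h2
    rw [hT p hp] at h3
    omega
  subst hed
  have haugT : ∀ a, ∀ m ∈ (F.aug a).support, m ∈ T := by
    intro a m hm
    obtain ⟨h1, w, hw, hwm⟩ := hsuppT a m hm
    rwa [← eq_of_le_of_degree_eq hwm ((hT w hw).trans h1.symm)]
  -- By degree, scalar coefficients suffice; the part in `S` commutes with scalars but not with
  -- multiplication by polynomials.
  have hconst : ∀ w ∈ T, ∃ c : Fin (F.rank 0) → k, ∑ a, C (c a) * F.aug a = monomial w 1 := by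
    intro w hw
    obtain ⟨y, hy⟩ := hgen w hw
    refine ⟨fun a => coeff 0 (y a), ?_⟩
    have h := congrArg (homogeneousComponent (0 + e)) hy
    rw [map_sum, homogeneousComponent_of_mem (isHomogeneous_monomial 1 (hT w hw)),
      if_pos (zero_add e)] at h
    rw [← h]
    refine Finset.sum_congr rfl fun a _ => ?_
    rw [homogeneousComponent_mul_of_isHomogeneous (haug a), homogeneousComponent_zero]
  obtain ⟨cp, hcp⟩ := hconst p hp
  obtain ⟨cq, hcq⟩ := hconst q hq
  -- The syzygy between `p` and `q` in degree `M`. Restricted to `S` it has coefficient 1 at `M`,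
  -- whereas its expression through linear syzygies, none of which crosses `S` below `M`, gives 0.
  let s : Fin (F.rank 0) → MvPolynomial (Fin n) k := fun a =>
    monomial (M - p) 1 * C (cp a) - monomial (M - q) 1 * C (cq a)
  have hs : ∀ g : Fin (F.rank 0) → MvPolynomial (Fin n) k, ∑ a, s a * g a =
      monomial (M - p) 1 * ∑ a, C (cp a) * g a - monomial (M - q) 1 * ∑ a, C (cq a) * g a := by
    intro g
    rw [Finset.mul_sum, Finset.mul_sum, ← Finset.sum_sub_distrib]
    exact Finset.sum_congr rfl fun a _ => by simp only [s]; ring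
  have hs0 : ∑ a, s a * F.aug a = 0 := by
    rw [hs, hcp, hcq, monomial_mul, monomial_mul, tsub_add_cancel_of_le hpM,
      tsub_add_cancel_of_le hqM, sub_self]
  obtain ⟨y, hy⟩ := (F.exact_zero s).mp hs0
  have hone : coeff M (∑ a, s a * monomialPart S (F.aug a)) = 1 := by
    rw [hs, ← monomialPart_sum_C_mul, ← monomialPart_sum_C_mul, hcp, hcq,
      monomialPart_monomial S hpS, monomialPart_monomial_of_notMem S hqS, monomial_mul,
      tsub_add_cancel_of_le hpM]
    simp
  have hzero : coeff M (∑ a, s a * monomialPart S (F.aug a)) = 0 := by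
    have hsum : ∑ a, s a * monomialPart S (F.aug a) =
        ∑ b, y b * ∑ a, F.diff 0 a b * monomialPart S (F.aug a) := by
      rw [← hy]
      simp only [Matrix.mulVec, dotProduct, Finset.sum_mul, Finset.mul_sum]
      rw [Finset.sum_comm]
      exact Finset.sum_congr rfl fun b _ => Finset.sum_congr rfl fun a _ => by ring
    rw [hsum, coeff_sum]
    refine Finset.sum_eq_zero fun b _ => coeff_mul_eq_zero_of_forall_le fun m hm =>
      coeff_linear_syzygy_monomialPart hno haug haugT (fun a x hx => ?_) ?_ hm
    · have h := F.diff_homogeneous 0 a b x (mem_support_iff.mpr hx)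
      rw [hshift, hshift] at h
      refine (DFunLike.congr_fun Finsupp.degree_eq_weight_one x).symm.trans ?_
      omega
    · have h := (F.exact_zero ((F.diff 0).mulVec (Pi.single b 1))).mpr ⟨_, rfl⟩
      rw [Matrix.mulVec_single_one] at h
      exact h
  exact one_ne_zero (hone.symm.trans hzero)

end Crossing

/-! ### Shadows of lexsegments, and linear quotients for the special form of `u` and `v`. -/

section Lexsegments

variable {n : ℕ} [NeZero n]

theorem toLex_lt_of_apply_zero {a b : Fin n →₀ ℕ} (h : a 0 < b 0) : toLex a < toLex b :=
  toLex_lt_iff.mpr ⟨0, fun j hj => absurd hj (Fin.not_lt_zero j), h⟩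

theorem apply_zero_le_of_toLex_le {a b : Fin n →₀ ℕ} (h : toLex a ≤ toLex b) : a 0 ≤ b 0 := by
  by_contra! h'
  exact absurd h (toLex_lt_of_apply_zero h').not_ge

/-- For all monomials `w <_lex v` of degree `d` some `x₁ w / xᵢ` is at most `u`. -/
def ShadowCondition (d : ℕ) (u v : Fin n →₀ ℕ) : Prop :=
  ∀ w : Fin n →₀ ℕ, w.degree = d → toLex w < toLex v → ∃ (i : Fin n) (w' : Fin n →₀ ℕ),
    0 < w i ∧ w' + Finsupp.single i 1 = w + Finsupp.single 0 1 ∧ toLex w' ≤ toLex u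

/-- A monomial without x₁ is divided by its last variable, which keeps the quotient above `v`. One
with x₁ is divided by x₁; if the quotient drops below `v`, the condition names another variable to
divide by. -/
theorem ShadowCondition.shadow_lexsegment {d : ℕ} {u v : Fin n →₀ ℕ} (hv : v.degree = d)
    (hu0 : 0 < u 0) (hv0 : v 0 = 0) {z : Fin n} (hz : ∀ i, i ≤ z)
    (h : ShadowCondition d u v) :
    shadow (lexsegment d u v) =
      lexsegment (d + 1) (u + Finsupp.single 0 1) (v + Finsupp.single z 1) := by
  ext t
  constructor
  · rintro ⟨w, ⟨hd, hwu, hvw⟩, i, rfl⟩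
    exact ⟨by simp [hd], add_single_le_add_single hwu (Fin.zero_le i),
      add_single_le_add_single hvw (hz i)⟩
  · rintro ⟨hd, htu, hvt⟩
    rcases Nat.eq_zero_or_pos (t 0) with ht0 | ht0
    · have hne : t.support.Nonempty := by
        obtain ⟨i, hi⟩ := exists_pos_of_degree_pos (w := t) (by omega)
        exact ⟨i, by simpa using hi.ne'⟩
      obtain ⟨m, hm, hmax⟩ := t.support.exists_max_image id hne
      obtain ⟨w, rfl⟩ := exists_eq_add_single (Nat.pos_of_ne_zero (by simpa using hm))
      have hwd : w.degree = d := by simpa using hd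
      have hw0 : w 0 = 0 := by simp only [Finsupp.add_apply] at ht0; omega
      refine ⟨w, ⟨hwd, (toLex_lt_of_apply_zero (by omega)).le, ?_⟩, m, rfl⟩
      by_contra! hlt
      obtain ⟨i, hlow, hi⟩ := toLex_lt_iff.mp hlt
      obtain ⟨s, his, hs⟩ := exists_lt_of_degree_eq (hwd.trans hv.symm) hi (p := fun s => i < s)
        (fun j hji hij => hlow j (lt_of_le_of_ne (not_lt.mp hij) hji))
      have hsm : s ≤ m := hmax s (by simp; omega)
      have him : i < m := lt_of_lt_of_le his hsm
      have hiz : i < z := lt_of_lt_of_le him (hz m)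
      refine absurd hvt (not_le.mpr (toLex_lt_iff.mpr ⟨i, fun j hj => ?_, ?_⟩))
      · simp [(hj.trans him).ne', (hj.trans hiz).ne', hlow j hj]
      · simpa [him.ne', hiz.ne'] using hi
    · obtain ⟨w, rfl⟩ := exists_eq_add_single ht0
      have hwd : w.degree = d := by simpa using hd
      have hwu : toLex w ≤ toLex u := by
        rw [toLex_add, toLex_add] at htu
        exact le_of_add_le_add_right htu
      rcases le_or_gt (toLex v) (toLex w) with hvw | hwv
      · exact ⟨w, ⟨hwd, hwu, hvw⟩, 0, rfl⟩
      · obtain ⟨i, w', hi, hw', hw'u⟩ := h w hwd hwv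
        have hw0 : w 0 = 0 := by
          have := apply_zero_le_of_toLex_le hwv.le
          omega
        have hi0 : i ≠ 0 := by rintro rfl; omega
        have hw'0 : 0 < w' 0 := by
          have := DFunLike.congr_fun hw' 0
          simp [hi0] at this
          omega
        exact ⟨w', ⟨(degree_exchange hw').trans hwd, hw'u,
          (toLex_lt_of_apply_zero (by omega)).le⟩, i, hw'.symm⟩

/-- After one shadow the upper end is divisible by x₁², while x₁w/xᵢ contains x₁ only once. Hence
only the first shadow can fail to be a lexsegment. -/
theorem shadowCondition_add_single {d : ℕ} {u v : Fin n →₀ ℕ} (hu0 : 0 < u 0) (hv0 : v 0 = 0)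
    {z : Fin n} (hz0 : z ≠ 0) :
    ShadowCondition (d + 1) (u + Finsupp.single 0 1) (v + Finsupp.single z 1) := by
  intro w hwd hwv
  have hw0 : w 0 = 0 := by
    have := apply_zero_le_of_toLex_le hwv.le
    simp [hz0, hv0] at this
    exact this
  obtain ⟨i, hi⟩ := exists_pos_of_degree_pos (w := w) (by omega)
  obtain ⟨c, rfl⟩ := exists_eq_add_single hi
  have hc0 : c 0 = 0 := by simp only [Finsupp.add_apply] at hw0; omega
  exact ⟨i, c + Finsupp.single 0 1, hi, add_right_comm _ _ _,
    add_single_le_add_single (toLex_lt_of_apply_zero (by omega)).le le_rfl⟩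

theorem ShadowCondition.isCompletelyLexsegment {d : ℕ} {u v : Fin n →₀ ℕ} (hu : u.degree = d)
    (hv : v.degree = d) (hu0 : 0 < u 0) (hv0 : v 0 = 0) {z : Fin n} (hz : ∀ i, i ≤ z)
    (hz0 : z ≠ 0) (h : ShadowCondition d u v) : IsCompletelyLexsegment (lexsegment d u v) := by
  intro i
  induction i generalizing d u v with
  | zero => exact ⟨d, u, v, hu, hv, (toLex_lt_of_apply_zero (by omega)).le, rfl⟩
  | succ i ih =>
    rw [Function.iterate_succ_apply, h.shadow_lexsegment hv hu0 hv0 hz]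
    exact ih (by simp [hu]) (by simp [hv]) (by simp) (by simp [hv0, hz0])
      (shadowCondition_add_single hu0 hv0 hz0)

/-- A first difference up to `l` would require `b` to be positive there, hence index 0, which `0 < a
0` and `b 0 = 1` exclude. -/
theorem toLex_le_initial_form {a b : Fin n →₀ ℕ} {l : Fin n} (hb0 : b 0 = 1)
    (hb : ∀ j, j ≠ 0 → j ≤ l → b j = 0) (ha0 : 0 < a 0) (hab : toLex a ≤ toLex b) :
    a 0 = 1 ∧ ∀ j, j ≠ 0 → j ≤ l → a j = 0 := by
  rcases hab.lt_or_eq with hab | hab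
  · obtain ⟨i, hlow, hi⟩ := toLex_lt_iff.mp hab
    have hi0 : i ≠ 0 := by rintro rfl; omega
    have hil : l < i := by
      by_contra! h
      have := hb i hi0 h
      omega
    exact ⟨by rw [hlow 0 (lt_of_le_of_ne (Fin.zero_le i) hi0.symm), hb0],
      fun j hj hjl => by rw [hlow j (lt_of_le_of_lt hjl hil), hb j hj hjl]⟩
  · rw [toLex_inj.mp hab]
    exact ⟨hb0, hb⟩

/-- Linear quotients for the order `Precedes`, if `v = x_l x_z^(d-1)` with the last variable
`x_z` and `u = x₁ u'` with `u'` in the variables after `x_l`. -/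
theorem hasVariableColons_lexsegment {k : Type*} [Field k] {d : ℕ} {u v : Fin n →₀ ℕ}
    {l z : Fin n} (hz : ∀ i, i ≤ z) (hl0 : l ≠ 0) (hlz : l ≠ z)
    (hv : v = Finsupp.single l 1 + Finsupp.single z (d - 1)) (hvd : v.degree = d)
    (hu0 : u 0 = 1) (hul : ∀ j, j ≠ 0 → j ≤ l → u j = 0)
    {L : List (Fin n →₀ ℕ)} (hL : L.Pairwise Precedes) (hmem : ∀ w, w ∈ L ↔ w ∈ lexsegment d u v) :
    HasVariableColons k L := by
  have hlz' : l < z := lt_of_le_of_ne (hz l) hlz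
  have hz0 : z ≠ 0 := by rintro rfl; exact hl0 (le_antisymm (hz l) (Fin.zero_le l))
  have hvl : v l = 1 := by simp [hv, hlz]
  have hvlow : ∀ j, j ≠ l → j ≠ z → v j = 0 := fun j h1 h2 => by simp [hv, h1.symm, h2.symm]
  have hv0 : v 0 = 0 := hvlow 0 hl0.symm hz0.symm
  have hge : ∀ w : Fin n →₀ ℕ, w.degree = d → ∀ j ≤ l, 0 < w j → toLex v ≤ toLex w := by
    intro w hwd j hjl hj
    by_contra! hlt
    obtain ⟨i, hlow, hi⟩ := toLex_lt_iff.mp hlt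
    rcases eq_or_ne i z with rfl | hiz
    · obtain ⟨s, hs, -⟩ := exists_lt_of_degree_eq (hwd.trans hvd.symm) hi (p := fun _ => False)
        (fun s hs _ => hlow s (lt_of_le_of_ne (hz s) hs))
      exact hs
    · have hil : i = l := by
        by_contra h
        have := hvlow i h hiz
        omega
      subst hil
      rcases hjl.lt_or_eq with h | rfl
      · have := hvlow j h.ne (h.trans hlz').ne
        have := hlow j h
        omega
      · omega
  have hex : ∀ w : Fin n →₀ ℕ, w 0 = 0 → toLex v ≤ toLex w → ∃ j, j ≠ 0 ∧ j ≤ l ∧ 0 < w j := by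
    intro w hw0 hvw
    by_contra! h
    have hw : ∀ j ≤ l, w j = 0 := fun j hj => by
      rcases eq_or_ne j 0 with rfl | hj0
      · exact hw0
      · exact Nat.le_zero.mp (h j hj0 hj)
    refine absurd hvw (not_le.mpr (toLex_lt_iff.mpr ⟨l, fun j hj => ?_, ?_⟩))
    · rw [hw j hj.le, hvlow j hj.ne (hj.trans hlz').ne]
    · rw [hw l le_rfl, hvl]; exact one_pos
  refine hasVariableColons_of_pairwise (fun a b h => h.asymm) hL fun a ha b hb hab => ?_
  obtain ⟨had, hau, hva⟩ := (hmem a).mp ha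
  obtain ⟨hbd, hbu, hvb⟩ := (hmem b).mp hb
  rcases hab with ⟨ha0, hb0⟩ | ⟨ha0, hb0, hab⟩ | ⟨ha0, hb0, hab⟩
  -- Only `b` contains x₁: replace it by some x_j dividing `a` with j ≤ l. The result has no x₁ left
  -- and stays above `v` by `hge`.
  · obtain ⟨hb1, hbl⟩ := toLex_le_initial_form hu0 hul hb0 hbu
    obtain ⟨j, hj0, hjl, hj⟩ := hex a ha0 hva
    obtain ⟨c, hc⟩ := exists_exchange hb0 j
    have hc0 : c 0 = 0 := by
      have := DFunLike.congr_fun hc 0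
      simp [hj0, hb1] at this
      exact this
    have hcj : 0 < c j := by
      have := DFunLike.congr_fun hc j
      simp [hj0.symm] at this
      omega
    have hcd := (degree_exchange hc).trans hbd
    exact ⟨j, by rw [hbl j hj0 hjl]; exact hj, c,
      (hmem c).mpr ⟨hcd, (toLex_lt_of_apply_zero (by omega)).le, hge c hcd j hjl hcj⟩,
      Or.inl ⟨hc0, hb0⟩, by rw [← hc]; exact le_self_add⟩
  -- Neither contains x₁: trade a later variable of `b` for the first one where `a` is larger.
  · obtain ⟨t, hlow, ht⟩ := toLex_lt_iff.mp hab
    have ht0 : t ≠ 0 := by rintro rfl; omega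
    obtain ⟨s, hts, hs⟩ := exists_lt_of_degree_eq (hbd.trans had.symm) ht (p := fun s => t < s)
      (fun j hjt htj => hlow j (lt_of_le_of_ne (not_lt.mp htj) hjt))
    have hs0 : s ≠ 0 := (lt_of_le_of_lt (Fin.zero_le t) hts).ne'
    obtain ⟨c, hc⟩ := exists_exchange (Nat.zero_lt_of_lt hs) t
    have hbc := toLex_lt_exchange hc hts
    have hc0 : c 0 = 0 := (apply_exchange hc hs0.symm ht0.symm).trans hb0
    exact ⟨t, ht, c, (hmem c).mpr ⟨(degree_exchange hc).trans hbd,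
      (toLex_lt_of_apply_zero (by omega)).le, hvb.trans hbc.le⟩,
      Or.inr (Or.inl ⟨hc0, hb0, hbc⟩), by rw [← hc]; exact le_self_add⟩
  -- Both contain x₁ exactly once: trade an earlier variable, not x₁, for the last one where they
  -- differ. This raises the colex order and lowers the lex order, so the result stays below `u`.
  · obtain ⟨hb1, hbl⟩ := toLex_le_initial_form hu0 hul hb0 hbu
    obtain ⟨ha1, hal⟩ := toLex_le_initial_form hu0 hul ha0 hau
    obtain ⟨t, hhigh, ht⟩ := toColex_lt_iff.mp hab
    have ht0 : t ≠ 0 := by rintro rfl; omega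
    obtain ⟨s, hst, hs⟩ := exists_lt_of_degree_eq (hbd.trans had.symm) ht (p := fun s => s < t)
      (fun j hjt htj => hhigh j (lt_of_le_of_ne (not_lt.mp htj) hjt.symm))
    have hs0 : s ≠ 0 := by rintro rfl; omega
    obtain ⟨c, hc⟩ := exists_exchange (Nat.zero_lt_of_lt hs) t
    have hbc := toColex_lt_exchange hc hst
    have hcb := toLex_lt_exchange hc.symm hst
    have hc0 : 0 < c 0 := (apply_exchange hc hs0.symm ht0.symm) ▸ hb0
    exact ⟨t, ht, c, (hmem c).mpr ⟨(degree_exchange hc).trans hbd,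
      hcb.le.trans hbu, (toLex_lt_of_apply_zero (by omega)).le⟩,
      Or.inr (Or.inr ⟨hc0, hb0, hbc⟩), by rw [← hc]; exact le_self_add⟩

end Lexsegments

/-! ### The form of `u` and `v` forced by a linear resolution. -/

section Lexsegments

variable {n : ℕ}

/-- The power of the last variable is the smallest monomial of its degree. -/
theorem single_last_toLex_le {z : Fin n} (hz : ∀ i, i ≤ z) (w : Fin n →₀ ℕ) :
    toLex (Finsupp.single z w.degree) ≤ toLex w := by
  by_contra! hlt
  obtain ⟨i, hlow, hi⟩ := toLex_lt_iff.mp hlt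
  have hiz : i = z := by
    by_contra h
    simp [Ne.symm h] at hi
  subst hiz
  obtain ⟨s, hs, -⟩ := exists_lt_of_degree_eq (by simp) hi (p := fun _ => False)
    (fun s hs _ => hlow s (lt_of_le_of_ne (hz s) hs))
  exact hs

theorem exists_eq_add_single_of_le {a b : Fin n →₀ ℕ} (h : a ≤ b) (hd : b.degree = a.degree + 1) :
    ∃ i, b = a + Finsupp.single i 1 := by
  obtain ⟨c, rfl⟩ := exists_add_of_le h
  have hc : c.degree = 1 := by simpa using hd
  obtain ⟨i, hi⟩ := exists_pos_of_degree_pos (w := c) (by omega)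
  refine ⟨i, ?_⟩
  rw [eq_of_le_of_degree_eq (w := Finsupp.single i 1) (m := c)
    (by rw [Finsupp.single_le_iff]; omega) (by simp [hc])]

theorem toLex_le_single_least {d : ℕ} {v : Fin n →₀ ℕ} (hv : v.degree = d) {l : Fin n}
    (hlow : ∀ j < l, v j = 0) : toLex v ≤ toLex (Finsupp.single l d) := by
  by_contra! hlt
  obtain ⟨i, hi', hi⟩ := toLex_lt_iff.mp hlt
  have hil : l ≤ i := by
    by_contra! h
    have := hlow i h
    omega
  have hld : d ≤ v l := by
    rcases hil.lt_or_eq with h | rfl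
    · rw [← hi' l h]; simp
    · simp at hi; omega
  have := eq_of_le_of_degree_eq (w := Finsupp.single l d) (m := v)
    (by rwa [Finsupp.single_le_iff]) (by simp [hv])
  rw [this] at hi
  exact lt_irrefl _ hi

variable [NeZero n]

/-- Failure of the condition that makes the shadows lexsegments, combined with a linear relation
between a generator divisible by `x₁` and one that is not, both of them in the variables `x₁`,
`x_l`, `x_z` with `x_l` the first variable of `v` and `x_z` the last one, determines `v` and
the initial variables of `u`. -/
theorem initial_form_of_crossing {d : ℕ} {u v : Fin n →₀ ℕ} (hv : v.degree = d)
    (hu0 : 0 < u 0) {l z : Fin n} (hz : ∀ i, i ≤ z)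
    (hl0 : l ≠ 0) (hvl : 0 < v l) (hvlow : ∀ j < l, v j = 0)
    {w₀ : Fin n →₀ ℕ} (hw₀d : w₀.degree = d) (hw₀v : toLex w₀ < toLex v)
    (hw₀ : ∀ (i : Fin n) (w' : Fin n →₀ ℕ), 0 < w₀ i →
      w' + Finsupp.single i 1 = w₀ + Finsupp.single 0 1 → toLex u < toLex w')
    {w₁ w₂ : Fin n →₀ ℕ} {i : Fin n} (hi : i = l ∨ i = z)
    (hw : w₁ + Finsupp.single i 1 = w₂ + Finsupp.single 0 1)
    (hw₁u : toLex w₁ ≤ toLex u) (hvw₂ : toLex v ≤ toLex w₂) (hw₂d : w₂.degree = d)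
    (hw₂0 : w₂ 0 = 0) (hsupp : ∀ j, j ≠ 0 → j ≠ l → j ≠ z → w₂ j = 0) :
    l ≠ z ∧ v = Finsupp.single l 1 + Finsupp.single z (d - 1) ∧
      u 0 = 1 ∧ ∀ j, j ≠ 0 → j ≤ l → u j = 0 := by
  have hw₀low : ∀ j < l, w₀ j = 0 := by
    intro j hj
    obtain ⟨s, hlow, hs⟩ := toLex_lt_iff.mp hw₀v
    have hls : l ≤ s := by
      by_contra! h
      have := hvlow s h
      omega
    rw [hlow j (lt_of_lt_of_le hj hls), hvlow j hj]
  have hdpos : 0 < d := by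
    have := Finsupp.le_degree l v
    omega
  have hne : w₀.support.Nonempty := by
    obtain ⟨j, hj⟩ := exists_pos_of_degree_pos (w := w₀) (by omega)
    exact ⟨j, by simpa using hj.ne'⟩
  obtain ⟨m, hm, hmin⟩ := w₀.support.exists_min_image id hne
  have hm0 : 0 < w₀ m := Nat.pos_of_ne_zero (by simpa using hm)
  have hw₀m : ∀ j < m, w₀ j = 0 := by
    intro j hj
    by_contra h
    exact absurd (hmin j (by simpa using h)) (not_le.mpr hj)
  have him : i < m := by
    by_contra! hmi
    obtain ⟨w', hw'⟩ := exists_exchange hm0 0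
    have huw' := hw₀ m w' hm0 hw'
    -- From w₁ < w', multiplying by xᵢx_m and cancelling x₁ yields w₂x_m < w₀xᵢ, impossible since w₀
    -- < w₂ and xᵢ ≤ x_m when m ≤ i.
    have h1 : toLex (w₁ + Finsupp.single i 1) + toLex (Finsupp.single m 1) <
        toLex (w' + Finsupp.single m 1) + toLex (Finsupp.single i 1) := by
      rw [toLex_add, toLex_add, add_right_comm]
      exact add_lt_add_left (add_lt_add_left (hw₁u.trans_lt huw') _) _
    rw [hw, hw', toLex_add, toLex_add, add_right_comm, add_right_comm (toLex w₀)] at h1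
    have h2 := lt_of_add_lt_add_right h1
    refine absurd h2 (not_lt.mpr (add_le_add (hw₀v.trans_le hvw₂).le
      (Finsupp.Lex.single_le_iff.mpr hmi)))
  have hil : i = l := by
    rcases hi with rfl | rfl
    · rfl
    · exact absurd him (not_lt.mpr (hz m))
  subst hil
  have hiz : i ≠ z := (him.trans_le (hz m)).ne
  have hm0' : m ≠ 0 := (lt_of_le_of_lt (Fin.zero_le i) him).ne'
  obtain ⟨w', hw'⟩ := exists_exchange hm0 0
  have hw'0 : w' 0 = 1 := by
    have := DFunLike.congr_fun hw' 0
    simpa [hm0', hw₀m 0 (lt_of_le_of_ne (Fin.zero_le m) hm0'.symm)] using this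
  have hw'l : ∀ j, j ≠ 0 → j ≤ i → w' j = 0 := by
    intro j hj hji
    rw [apply_exchange hw' (lt_of_le_of_lt hji him).ne hj, hw₀m j (lt_of_le_of_lt hji him)]
  -- The monomial x₁w₀/x_m lies above `u` and involves no variable up to x_l except x₁ once, so `u`
  -- inherits this, and then so does `w₁`.
  obtain ⟨hu1, hul⟩ := toLex_le_initial_form hw'0 hw'l hu0 (hw₀ m w' hm0 hw').le
  have hw₁0 : 0 < w₁ 0 := by
    have := DFunLike.congr_fun hw 0
    simp [hl0] at this
    omega
  obtain ⟨-, hw₁l⟩ := toLex_le_initial_form hu1 hul hw₁0 hw₁u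
  have hw₂i : w₂ i = 1 := by
    have := DFunLike.congr_fun hw i
    simp [hl0.symm, hw₁l i hl0 le_rfl] at this
    exact this.symm
  have hz0 : z ≠ 0 := by rintro rfl; exact hl0 (le_antisymm (hz i) (Fin.zero_le i))
  have hw₂eq : w₂ = Finsupp.single i 1 + Finsupp.single z (w₂ z) := by
    ext j
    rcases eq_or_ne j i with rfl | hji
    · simp [hw₂i, hiz]
    · rcases eq_or_ne j z with rfl | hjz
      · simp [hiz]
      · rcases eq_or_ne j 0 with rfl | hj0
        · simp [hw₂0, hji, hjz]
        · simp [hsupp j hj0 hji hjz, hji, hjz]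
  have hw₂z : w₂ z = d - 1 := by
    have := congrArg Finsupp.degree hw₂eq
    rw [map_add, Finsupp.degree_single, Finsupp.degree_single, hw₂d] at this
    omega
  rw [hw₂z] at hw₂eq
  refine ⟨hiz, ?_, hu1, hul⟩
  rw [← hw₂eq]
  -- A first difference at x_l contradicts `0 < v l`, and one at the last variable contradicts
  -- equality of degrees.
  rcases hvw₂.lt_or_eq with hlt | heq
  · exfalso
    obtain ⟨s, hlow, hs⟩ := toLex_lt_iff.mp hlt
    have hsz : s = z := by
      by_contra hsz
      have hsi : s = i := by
        by_contra hsi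
        simp [hw₂eq, Ne.symm hsi, Ne.symm hsz] at hs
      subst hsi
      omega
    subst hsz
    obtain ⟨t, ht, -⟩ := exists_lt_of_degree_eq (hv.trans hw₂d.symm) hs (p := fun _ => False)
      (fun t ht _ => hlow t (lt_of_le_of_ne (hz t) ht))
    exact ht
  · exact toLex_inj.mp heq

/-- A lexsegment ideal that is not completely lexsegment and has a linear resolution is generated
by `𝓛(u, v)` with `v = x_l x_z^(d-1)`, `x_z` the last variable, and `u = x₁ u'` with `u'` in the
variables after `x_l`. -/
theorem initial_form_of_hasLinearResolution {k : Type*} [Field k] {d : ℕ} {u v : Fin n →₀ ℕ}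
    (hd : 0 < d) (hu : u.degree = d) (hv : v.degree = d) (hu0 : 0 < u 0) (hv0 : v 0 = 0)
    (hI : ¬ IsCompletelyLexsegment (lexsegment d u v))
    (hlin : HasLinearResolution (monomialSpan k (lexsegment d u v))) :
    ∃ l z : Fin n, (∀ i, i ≤ z) ∧ l ≠ 0 ∧ l ≠ z ∧
      v = Finsupp.single l 1 + Finsupp.single z (d - 1) ∧
      u 0 = 1 ∧ ∀ j, j ≠ 0 → j ≤ l → u j = 0 := by
  obtain ⟨z, hz⟩ : ∃ z : Fin n, ∀ i, i ≤ z :=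
    ⟨⟨n - 1, Nat.sub_one_lt (NeZero.ne n)⟩, fun i => by rw [Fin.le_def]; simp only; omega⟩
  have hne : v.support.Nonempty := by
    obtain ⟨j, hj⟩ := exists_pos_of_degree_pos (w := v) (by omega)
    exact ⟨j, by simpa using hj.ne'⟩
  obtain ⟨l, hl, hmin⟩ := v.support.exists_min_image id hne
  have hvl : 0 < v l := Nat.pos_of_ne_zero (by simpa using hl)
  have hvlow : ∀ j < l, v j = 0 := by
    intro j hj
    by_contra h
    exact absurd (hmin j (by simpa using h)) (not_le.mpr hj)
  have hl0 : l ≠ 0 := by rintro rfl; omega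
  have hz0 : z ≠ 0 := by rintro rfl; exact hl0 (le_antisymm (hz l) (Fin.zero_le l))
  have hcond : ¬ ShadowCondition d u v := fun h =>
    hI (h.isCompletelyLexsegment hu hv hu0 hv0 hz hz0)
  unfold ShadowCondition at hcond
  push Not at hcond
  obtain ⟨w₀, hw₀d, hw₀v, hw₀⟩ := hcond
  -- `p` is the least monomial of degree `d` divisible by x₁, so it lies in the segment. The product
  -- `M` involves only x₁, x_l, x_z, and x₁ just once, which confines the crossing to these
  -- variables.
  let p : Fin n →₀ ℕ := Finsupp.single z (d - 1) + Finsupp.single 0 1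
  let q : Fin n →₀ ℕ := Finsupp.single l d
  let M : Fin n →₀ ℕ := p + q
  have hp : p ∈ lexsegment d u v := by
    refine ⟨by simp only [p, map_add, Finsupp.degree_single]; omega, ?_, (toLex_lt_of_apply_zero (by simp [p, hv0])).le⟩
    obtain ⟨c, rfl⟩ := exists_eq_add_single hu0
    have hc : d - 1 = c.degree := by simp at hu; omega
    exact add_single_le_add_single (hc ▸ single_last_toLex_le hz c) le_rfl
  have hq : q ∈ lexsegment d u v :=
    ⟨by simp [q], (toLex_lt_of_apply_zero (by simp [q, hl0, hu0])).le,
      toLex_le_single_least hv hvlow⟩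
  obtain ⟨M', hM', hM'd, w₁, hw₁, w₂, hw₂, hw₁M, hw₂M, hw₁0, hw₂0⟩ :=
    exists_linear_crossing (S := {w | 0 < w 0}) (M := M) (fun w hw => hw.1) hlin hp hq
      (by simp [p]) (by simp [q, hl0]) le_self_add le_add_self
  have hw₁0 : 0 < w₁ 0 := hw₁0
  have hw₂0 : w₂ 0 = 0 := Nat.eq_zero_of_not_pos hw₂0
  have hM0 : M 0 = 1 := by simp [M, p, q, hl0, hz0]
  have hMsupp : ∀ j, j ≠ 0 → j ≠ l → j ≠ z → M j = 0 := fun j h1 h2 h3 => by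
    simp [M, p, q, h1.symm, h2.symm, h3.symm]
  obtain ⟨i', hi'⟩ := exists_eq_add_single_of_le hw₂M (by rw [hM'd, hw₂.1])
  obtain ⟨i, hi⟩ := exists_eq_add_single_of_le hw₁M (by rw [hM'd, hw₁.1])
  have hi'0 : i' = 0 := by
    by_contra h
    have h1 := hw₁M 0
    rw [hi'] at h1
    simp [hw₂0, h] at h1
    omega
  subst hi'0
  have hi0 : i ≠ 0 := by
    rintro rfl
    have h1 := hM' 0
    rw [hi, hM0] at h1
    simp at h1
    omega
  have hilz : i = l ∨ i = z := by
    by_contra! h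
    have h1 := hM' i
    rw [hi, hMsupp i hi0 h.1 h.2] at h1
    simp at h1
  obtain ⟨h1, h2, h3, h4⟩ := initial_form_of_crossing hv hu0 hz hl0 hvl hvlow hw₀d hw₀v hw₀ hilz
    (hi.symm.trans hi') hw₁.2.1 hw₂.2.2 hw₂.1 hw₂0
    (fun j hj0 hjl hjz => Nat.le_zero.mp ((hMsupp j hj0 hjl hjz) ▸ (hw₂M j).trans (hM' j)))
  exact ⟨l, z, hz, hl0, h1, h2, h3, h4⟩

end Lexsegments

end LexSeg

theorem theorem2p1 {k : Type*} [Field k] {n : ℕ} [NeZero n] (d : ℕ) (hd : 2 ≤ d)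
    (u v : Fin n →₀ ℕ) (hu : u.degree = d) (hv : v.degree = d)
    (hu0 : 0 < u 0) (hv0 : v 0 = 0)
    (hI : ¬ LexSeg.IsCompletelyLexsegmentIdeal
      (LexSeg.monomialSpan k (LexSeg.lexsegment d u v))) :
    (LexSeg.HasLinearResolution (LexSeg.monomialSpan k (LexSeg.lexsegment d u v)) ↔
      LexSeg.HasLinearQuotients (LexSeg.monomialSpan k (LexSeg.lexsegment d u v))) ∧
    (LexSeg.HasLinearResolution (LexSeg.monomialSpan k (LexSeg.lexsegment d u v)) →
      ∃ l : List (Fin n →₀ ℕ), l.Pairwise LexSeg.Precedes ∧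
        LexSeg.HasLinearQuotientsFor (LexSeg.monomialSpan k (LexSeg.lexsegment d u v)) l) := by
  have hdeg : ∀ w ∈ LexSeg.lexsegment d u v, w.degree = d := fun w hw => hw.1
  have hmain : LexSeg.HasLinearResolution (LexSeg.monomialSpan k (LexSeg.lexsegment d u v)) →
      ∃ l : List (Fin n →₀ ℕ), l.Pairwise LexSeg.Precedes ∧
        LexSeg.HasLinearQuotientsFor (LexSeg.monomialSpan k (LexSeg.lexsegment d u v)) l := by
    intro hlin
    -- The hypothesis on the ideal enters only through its generating set `𝓛(u, v)`.
    obtain ⟨l, z, hz, hl0, hlz, hveq, hu1, hul⟩ := LexSeg.initial_form_of_hasLinearResolution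
      (by omega) hu hv hu0 hv0 (fun h => hI ⟨_, h, rfl⟩) hlin
    obtain ⟨L, hnodup, hpair, hmem⟩ :=
      LexSeg.exists_pairwise_precedes (LexSeg.finite_of_degree_eq hdeg)
    refine ⟨L, hpair, ⟨hnodup, fun w => ?_⟩, LexSeg.hasVariableColons_lexsegment hz hl0 hlz hveq hv
      hu1 hul hpair hmem⟩
    rw [LexSeg.minimalGenerators_monomialSpan hdeg]
    exact hmem w
  refine ⟨⟨fun h => ?_, LexSeg.hasLinearResolution_of_hasLinearQuotients hdeg⟩, hmain⟩
  obtain ⟨L, -, hL⟩ := hmain h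
  exact ⟨L, hL⟩
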